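/- Let $G$ be a Polish group (a topological group whose topology is separable and completely metrizable) that admits a two-sided invariant metric, i.e. whose topology is induced by a metric $d$ with $d(ax,ay)=d(x,y)=d(xa,ya)$ for all $a,x,y\in G$. Let $X\subseteq G$ be meager-additive, i.e. $MX=\{mx : m\in M,\ x\in X\}$ is meager in $G$ for every meager set $M\subseteq G$. Then $X$ has sharp measure zero with respect to every metric $\rho$ on $G$ that induces the topology of $G$; that is, for every sequence $(\varepsilon_n)_{n\in\mathbb N}$ of positive reals there are sets $U_n\subseteq G$ $(n\in\mathbb N)$ with $\operatorname{diam}_\rho U_n\le\varepsilon_n$ for all $n$, and a partition $\mathbb N=I_0\cup I_1\cup I_2\cup\dots$ into consecutive nonempty finite intervals ($I_{j+1}$ immediately to the right of $I_j$), such that each $x\in X$ belongs to $\bigcup_{n\in I_j}U_n$ for all but finitely many $j$. -/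

import Mathlib

open scoped Pointwise

/-- A set `X` in a topological group is meager-additive if `M * X` is meager for every meager
set `M`. -/
def IsMeagerAdditive {G : Type*} [Group G] [TopologicalSpace G] (X : Set G) : Prop :=
  ∀ M : Set G, IsMeagre M → IsMeagre (M * X)

/-- The metric `d` induces the topology `τ`. -/
def IsCompatibleMetric {E : Type*} (τ : TopologicalSpace E) (d : MetricSpace E) : Prop :=
  d.toUniformSpace.toTopologicalSpace = τ

/-- The topology of the group is induced by some two-sided invariant metric. -/
def AdmitsInvariantMetric (G : Type*) [Group G] [τ : TopologicalSpace G] : Prop :=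
  ∃ d : MetricSpace G, IsCompatibleMetric τ d ∧
    (∀ a x y : G, d.dist (a * x) (a * y) = d.dist x y) ∧
    (∀ a x y : G, d.dist (x * a) (y * a) = d.dist x y)

/-- `U` is a `γ`-cover of `S`: each point of `S` belongs to all but finitely many `U n`. -/
def IsGammaCover {E : Type*} (S : Set E) (U : ℕ → Set E) : Prop :=
  ∀ x ∈ S, {n : ℕ | x ∉ U n}.Finite

/-- `U` is a `γ`-groupable cover of `S`: there is a partition of `ℕ` into consecutive nonempty
finite intervals `I j = [g j, g (j + 1))`, `j ∈ ℕ`, such that the unions of the `U n` over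
`n ∈ I j` form a `γ`-cover of `S`. -/
def IsGammaGroupableCover {E : Type*} (S : Set E) (U : ℕ → Set E) : Prop :=
  ∃ g : ℕ → ℕ, g 0 = 0 ∧ StrictMono g ∧
    IsGammaCover S (fun j => ⋃ n ∈ Set.Ico (g j) (g (j + 1)), U n)

/-- A subset `S` of a metric space has sharp measure zero if for every sequence `ε` of positive
reals it has a `γ`-groupable cover `U` with `diam (U n) ≤ ε n` for all `n`. Diameters are taken in
`[0, ∞]`, so unbounded sets have diameter `∞`. Replacing `U n` by `U n ∩ S` shows that it makes no
difference whether the covering sets are subsets of `S` or of the ambient space. -/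
def HasSharpMeasureZero {E : Type*} [MetricSpace E] (S : Set E) : Prop :=
  ∀ ε : ℕ → ℝ, (∀ n, 0 < ε n) →
    ∃ U : ℕ → Set E, IsGammaGroupableCover S U ∧
      ∀ n, Metric.ediam (U n) ≤ ENNReal.ofReal (ε n)

/-! ### Interval partitions and groupable covers -/

/-! The invariant metric is complete. A discrete `G` is countable, and singletons suffice. Otherwise
remove from `G` holes of radius `η (n + 1) / 16` about a dense sequence `q n`; a closed nowhere
dense set `M` remains, and `M * X` lies in a union of closed nowhere dense sets `F j`. Baire
category on `M` (`exists_forall_meets`) splits `X` into countably many pieces `Y`: for `x ∈ Y`, the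
right translates by `x` of all hole-avoiding balls inside one fixed ball meet one fixed `F j`. A
suitable `y` off `F j` then forces `y * x⁻¹` near a hole `q n`, so `x` is near `(q n)⁻¹ * y`
(`hasHoleCovers`). Thus a small part of `Y` needs only one ball per index `n`, of radius about `η (n
+ 1)`.

A first scale shows that `X` lies in a `σ`-compact set. The number of small parts at each stage is
then finite and known before the next radius is chosen. A second scale reserves in block `n` one
index per part, and makes `η (n + 1)` small enough for every tolerance in that block. -/

theorem exists_block_index {c : ℕ → ℕ} (hc : StrictMono c) (h0 : c 0 = 0) :
    ∃ b : ℕ → ℕ, (∀ p, c (b p) ≤ p ∧ p < c (b p + 1)) ∧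
      ∀ n p, c n ≤ p → p < c (n + 1) → b p = n := by
  have h : ∀ p, ∃ n, c n ≤ p ∧ p < c (n + 1) := by
    intro p
    induction p with
    | zero => exact ⟨0, h0.le, h0.symm.trans_lt (hc (Nat.lt_succ_self 0))⟩
    | succ p ih =>
      obtain ⟨n, hn, hp⟩ := ih
      rcases (Nat.succ_le_of_lt hp).lt_or_eq with h | h
      · exact ⟨n, by omega, h⟩
      · exact ⟨n + 1, h.ge, h.trans_lt (hc (Nat.lt_succ_self _))⟩
  choose b hb using h
  refine ⟨b, hb, fun n p h1 h2 => ?_⟩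
  have h3 := hc.lt_iff_lt.1 ((hb p).1.trans_lt h2)
  have h4 := hc.lt_iff_lt.1 (h1.trans_lt (hb p).2)
  omega

/-- Covers of the sets `A l` by consecutive blocks of arbitrarily late indices can be pasted
together to a `γ`-groupable cover. -/
theorem exists_isGammaGroupableCover {E : Type*} {S : Set E} {A : ℕ → Set E}
    (Q : ℕ → Set E → Prop) (hA : ∀ x ∈ S, ∃ m, ∀ l ≥ m, x ∈ A l)
    {c : ℕ → ℕ} (hc : StrictMono c) (h0 : c 0 = 0)
    (h : ∀ l, ∃ N > l, ∃ V : ℕ → Set E, (∀ p, Q p (V p)) ∧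
      A l ⊆ ⋃ p ∈ Set.Ico (c l) (c N), V p) :
    ∃ U : ℕ → Set E, IsGammaGroupableCover S U ∧ ∀ p, Q p (U p) := by
  choose N hN V hV hcov using h
  let L : ℕ → ℕ := fun j => N^[j] 0
  have hLs : ∀ j, L (j + 1) = N (L j) := fun j => Function.iterate_succ_apply' N j 0
  have hL : StrictMono L := strictMono_nat_of_lt_succ fun j => by rw [hLs]; exact hN _
  have hg : StrictMono (fun j => c (L j)) := hc.comp hL
  obtain ⟨b, -, hb⟩ := exists_block_index hg h0
  refine ⟨fun p => V (L (b p)) p, ⟨fun j => c (L j), h0, hg, fun x hx => ?_⟩, fun p => hV _ _⟩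
  obtain ⟨m, hm⟩ := hA x hx
  refine (Set.finite_lt_nat m).subset fun j hj => ?_
  by_contra hjm
  refine hj ?_
  have hx' := hcov (L j) (hm _ ((not_lt.1 hjm).trans hL.le_apply))
  simp only [Set.mem_iUnion, exists_prop, ← hLs] at hx' ⊢
  obtain ⟨p, hp, hxp⟩ := hx'
  refine ⟨p, hp, ?_⟩
  rwa [hb j p hp.1 hp.2]

theorem HasSharpMeasureZero.of_countable {E : Type*} [MetricSpace E] [Countable E] [Nonempty E]
    (S : Set E) : HasSharpMeasureZero S := by
  intro ε _
  obtain ⟨e, he⟩ := exists_surjective_nat E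
  refine exists_isGammaGroupableCover (A := fun l => e '' Set.Iic l)
    (fun p U => Metric.ediam U ≤ ENNReal.ofReal (ε p)) (fun x _ => ?_) strictMono_id rfl
    -- The `l + 1` indices from `l` on list `e 0, ..., e l`.
    fun l => ⟨l + (l + 1), by omega, fun p => {e (p - l)}, fun p => by simp, ?_⟩
  · obtain ⟨m, rfl⟩ := he x
    exact ⟨m, fun l hl => ⟨m, hl, rfl⟩⟩
  · rintro _ ⟨m, hm, rfl⟩
    have hm : m ≤ l := hm
    simp only [Set.mem_iUnion, exists_prop]
    exact ⟨l + m, ⟨by simp, by simp; omega⟩, by simp⟩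

/-! ### Completeness of invariant metrics -/

theorem baireSpace_of_isCompletelyMetrizableSpace (X : Type*) [τ : TopologicalSpace X]
    [h : TopologicalSpace.IsCompletelyMetrizableSpace X] : BaireSpace X := by
  obtain ⟨m, rfl, hm⟩ := h.complete
  infer_instance

/-- Stating a complete metric as a bare function lets it coexist with the invariant metric instance.
-/
theorem exists_dist_of_isCompletelyMetrizableSpace (X : Type*) [τ : TopologicalSpace X]
    [h : TopologicalSpace.IsCompletelyMetrizableSpace X] : ∃ D : X → X → ℝ,
      (∀ z ε, 0 < ε → {u | D u z < ε} ∈ nhds z) ∧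
      ∀ x : ℕ → X, (∀ ε > 0, ∃ z, ∃ n₀ : ℕ, ∀ n ≥ n₀, D (x n) z < ε) →
        ∃ l, Filter.Tendsto x Filter.atTop (nhds l) := by
  obtain ⟨m, rfl, hm⟩ := h.complete
  refine ⟨dist, fun z ε hε => Metric.ball_mem_nhds z hε, fun x hx => ?_⟩
  refine cauchySeq_tendsto_of_complete (Metric.cauchySeq_iff'.2 fun ε hε => ?_)
  obtain ⟨z, n₀, hz⟩ := hx (ε / 2) (half_pos hε)
  exact ⟨n₀, fun n hn => by linarith [hz n hn, hz n₀ le_rfl, dist_triangle_right (x n) (x n₀) z]⟩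

/-- A two-sided invariant metric on a completely metrizable group is complete. -/
theorem completeSpace_of_isIsometricSMul (G : Type*) [Group G] [MetricSpace G]
    [IsIsometricSMul G G] [IsIsometricSMul Gᵐᵒᵖ G]
    [h : TopologicalSpace.IsCompletelyMetrizableSpace G] : CompleteSpace G := by
  have hB := baireSpace_of_isCompletelyMetrizableSpace G
  obtain ⟨D, hDball, hD⟩ := exists_dist_of_isCompletelyMetrizableSpace G
  refine UniformSpace.complete_of_cauchySeq_tendsto fun x hx => ?_
  have hball : ∀ (z : G) (ε : ℝ), 0 < ε → ∃ s > 0, ∀ u, dist u z < s → D u z < ε := by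
    intro z ε hε
    obtain ⟨s, hs, hsub⟩ := Metric.mem_nhds_iff.1 (hDball z ε hε)
    exact ⟨s, hs, fun u hu => hsub hu⟩
  -- A `g` in every `A k` makes `x n * g` Cauchy for the complete metric behind `D`; translating its
  -- limit back gives a limit of `x`.
  let A : ℕ → Set G := fun k => {g | ∃ r > 0, ∃ n₀ : ℕ, ∃ z : G, ∀ n ≥ n₀, ∀ u,
    dist u (x n * g) < r → D u z < 1 / ((k : ℝ) + 1)}
  have hopen : ∀ k, IsOpen (A k) := by
    intro k
    rw [Metric.isOpen_iff]
    rintro g ⟨r, hr, n₀, z, hz⟩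
    refine ⟨r / 2, by positivity, fun g' hg' => ⟨r / 2, by positivity, n₀, z, fun n hn u hu => ?_⟩⟩
    refine hz n hn u ?_
    have h1 : dist (x n * g') (x n * g) < r / 2 := by
      rw [dist_mul_left]; exact hg'
    linarith [dist_triangle u (x n * g') (x n * g)]
  have hdense : ∀ k, Dense (A k) := by
    intro k
    rw [Metric.dense_iff]
    intro g r hr
    obtain ⟨n₁, hn₁⟩ := Metric.cauchySeq_iff.1 hx r hr
    obtain ⟨s, hs, hsb⟩ := hball (x n₁ * g) (1 / ((k : ℝ) + 1)) (by positivity)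
    obtain ⟨n₂, hn₂⟩ := Metric.cauchySeq_iff.1 hx (s / 2) (by positivity)
    let n := max n₁ n₂
    refine ⟨(x n)⁻¹ * (x n₁ * g), ?_, s / 2, by positivity, n, x n₁ * g, fun i hi u hu => ?_⟩
    · rw [Metric.mem_ball, ← dist_mul_left (x n), mul_inv_cancel_left, dist_mul_right]
      exact hn₁ _ le_rfl _ (le_max_left _ _)
    · refine hsb u ?_
      have h1 : dist (x i * ((x n)⁻¹ * (x n₁ * g))) (x n₁ * g) < s / 2 := by
        have : dist (x i * ((x n)⁻¹ * (x n₁ * g))) (x n₁ * g)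
            = dist (x i * ((x n)⁻¹ * (x n₁ * g))) (x n * ((x n)⁻¹ * (x n₁ * g))) := by
          rw [mul_inv_cancel_left]
        rw [this, dist_mul_right]
        exact hn₂ _ ((le_max_right _ _).trans hi) _ (le_max_right _ _)
      linarith [dist_triangle u (x i * ((x n)⁻¹ * (x n₁ * g))) (x n₁ * g)]
  obtain ⟨g, hg⟩ := (dense_iInter_of_isOpen hopen hdense).nonempty
  rw [Set.mem_iInter] at hg
  obtain ⟨z, hz⟩ := hD (fun n => x n * g) fun ε hε => by
    obtain ⟨k, hk⟩ := exists_nat_one_div_lt hε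
    obtain ⟨r, hr, n₀, z, hz⟩ := hg k
    exact ⟨z, n₀, fun n hn => (hz n hn _ (by simpa using hr)).trans hk⟩
  refine ⟨z * g⁻¹, ?_⟩
  rw [tendsto_iff_dist_tendsto_zero] at hz ⊢
  refine hz.congr fun n => ?_
  rw [← dist_mul_right (x n) _ g, inv_mul_cancel_right]

/-! ### Nowhere dense sets with small holes -/

/-- A fast decreasing sequence of radii such that every ball of radius `η n / 2` contains two points
more than `4 * η (n + 1)` apart. -/
structure IsHoleScale (G : Type*) [Group G] [MetricSpace G] (η : ℕ → ℝ) : Prop where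
  pos : ∀ n, 0 < η n
  shrink : ∀ n, 16 * η (n + 1) ≤ η n
  gap : ∀ n, ∃ a : G, 4 * η (n + 1) < dist a 1 ∧ dist a 1 < η n / 2

/-- The complement of the union of the balls of radius `η (n + 1) / 16` about the `q n`. -/
def holeComplement {G : Type*} [MetricSpace G] (η : ℕ → ℝ) (q : ℕ → G) : Set G :=
  {z | ∀ n, η (n + 1) / 16 ≤ dist z (q n)}

/-- The ball of radius `η k` about `q a` avoids the first `k` holes. -/
def AvoidsHoles {G : Type*} [MetricSpace G] (η : ℕ → ℝ) (q : ℕ → G) (a k : ℕ) : Prop :=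
  ∀ n < k, η (n + 1) / 16 + η k < dist (q a) (q n)

/-- Small enough pieces of `Y` have finite covers by balls whose radii are essentially those
of the holes of arbitrarily late index. -/
def HasHoleCovers {G : Type*} [Group G] [MetricSpace G] (η : ℕ → ℝ) (q : ℕ → G) (Y : Set G)
    (k : ℕ) : Prop :=
  ∀ l ≥ k, ∀ x₀ : G, ∀ N₀ : ℕ, ∃ N ≥ N₀, ∃ y : G, Y ∩ Metric.ball x₀ (η l / 4) ⊆
    ⋃ n ∈ Set.Ico l N, Metric.ball ((q n)⁻¹ * y) (η (n + 1) / 16 + 2 * η N)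

theorem isMeagre_holeComplement {G : Type*} [MetricSpace G] {η : ℕ → ℝ} (hη : ∀ n, 0 < η n)
    {q : ℕ → G} (hq : DenseRange q) : IsMeagre (holeComplement η q) := by
  have h : (holeComplement η q)ᶜ = ⋃ n, Metric.ball (q n) (η (n + 1) / 16) := by
    ext z
    simp [holeComplement]
  refine residual_of_dense_open ?_ ?_
  · rw [h]
    exact isOpen_iUnion fun n => Metric.isOpen_ball
  · rw [h]
    refine hq.mono ?_
    rintro _ ⟨n, rfl⟩
    exact Set.mem_iUnion.2 ⟨n, Metric.mem_ball_self (by have := hη (n + 1); positivity)⟩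

/-- If `r` bounds admissible scales at each stage and depends on integers built up on the way, then
a scale respecting the bounds exists. -/
theorem exists_isHoleScale (G : Type*) [Group G] [MetricSpace G]
    (hG : ∀ r > 0, ∃ a : G, a ≠ 1 ∧ dist a 1 < r) (C : ℕ → ℝ → ℕ → ℕ) (β : ℕ → ℕ → ℝ)
    (hβ : ∀ n m, 0 < β n m) :
    ∃ (η : ℕ → ℝ) (c : ℕ → ℕ), IsHoleScale G η ∧ c 0 = 0 ∧
      (∀ n, c (n + 1) = C n (η n) (c n)) ∧ ∀ n, η (n + 1) ≤ β n (c (n + 1)) := by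
  choose! f hf1 hf using hG
  -- The three bounds serve `shrink`, `gap` (5 exceeds the required 4) and `β`.
  let T : ℝ → ℕ → ℕ → ℝ := fun e n m => min (min (e / 16) (dist (f (e / 2)) 1 / 5)) (β n m)
  let s : ℕ → ℝ × ℕ := fun n => Nat.rec (1, 0)
    (fun n p => (T p.1 n (C n p.1 p.2), C n p.1 p.2)) n
  have hs : ∀ n, s (n + 1) = (T (s n).1 n (C n (s n).1 (s n).2), C n (s n).1 (s n).2) :=
    fun n => rfl
  have hpos : ∀ n, 0 < (s n).1 := by
    intro n
    induction n with
    | zero => exact one_pos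
    | succ n ih =>
      rw [hs]
      refine lt_min (lt_min (by positivity) ?_) (hβ _ _)
      have := dist_pos.2 (hf1 _ (half_pos ih))
      positivity
  have hle : ∀ n, (s (n + 1)).1 ≤ (s n).1 / 16 ∧ (s (n + 1)).1 ≤ dist (f ((s n).1 / 2)) 1 / 5 :=
    fun n => ⟨(min_le_left _ _).trans (min_le_left _ _), (min_le_left _ _).trans (min_le_right _ _)⟩
  refine ⟨fun n => (s n).1, fun n => (s n).2, ⟨hpos, fun n => ?_, fun n => ?_⟩, rfl, fun n => rfl,
    fun n => min_le_right _ _⟩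
  · linarith [(hle n).1]
  · refine ⟨f ((s n).1 / 2), ?_, hf _ (half_pos (hpos n))⟩
    linarith [(hle n).2, hpos (n + 1)]

namespace IsHoleScale

variable {G : Type*} [Group G] [MetricSpace G] {η : ℕ → ℝ} {q : ℕ → G}

theorem anti (hη : IsHoleScale G η) {m n : ℕ} (h : m ≤ n) : η n ≤ η m :=
  antitone_nat_of_succ_le (fun n => by linarith [hη.shrink n, hη.pos (n + 1)]) h

theorem tendsto_zero (hη : IsHoleScale G η) : Filter.Tendsto η Filter.atTop (nhds 0) := by
  have h : ∀ n, η n ≤ η 0 * (1 / 16) ^ n := by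
    intro n
    induction n with
    | zero => simp
    | succ n ih => rw [pow_succ]; linarith [hη.shrink n]
  refine squeeze_zero (fun n => (hη.pos n).le) h ?_
  simpa using (tendsto_pow_atTop_nhds_zero_of_lt_one (r := (1 / 16 : ℝ)) (by norm_num)
    (by norm_num)).const_mul (η 0)

theorem exists_lt (hη : IsHoleScale G η) {δ : ℝ} (hδ : 0 < δ) (N₀ : ℕ) : ∃ N ≥ N₀, η N < δ :=
  ((hη.tendsto_zero.eventually_lt_const hδ).and (Filter.eventually_ge_atTop N₀)).exists.imp
    fun _ h => ⟨h.2, h.1⟩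

/-- If `q a` is too close to the new hole, translating by the `gap` element moves it away. The move
is below `η k / 2`, so the old margin `η k` still leaves `η (k + 1)` around the earlier holes. -/
theorem exists_avoidsHoles_succ (hη : IsHoleScale G η) [IsIsometricSMul G G] (hq : DenseRange q)
    {a k : ℕ} (h : AvoidsHoles η q a k) :
    ∃ a', AvoidsHoles η q a' (k + 1) ∧ dist (q a) (q a') < η k / 2 := by
  obtain ⟨g, hg, hg'⟩ := hη.gap k
  have key : ∃ w, dist w (q a) < η k / 2 ∧ 2 * η (k + 1) < dist w (q k) := by
    by_cases h1 : 2 * η (k + 1) < dist (q a) (q k)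
    · exact ⟨q a, by simpa using hη.pos k, h1⟩
    · have h2 : dist (q a * g) (q a) = dist g 1 := by
        conv_lhs => rw [← mul_one (q a), mul_assoc, one_mul, dist_mul_left]
      refine ⟨q a * g, by rwa [h2], ?_⟩
      linarith [dist_triangle_right (q a * g) (q a) (q k)]
  obtain ⟨w, hw1, hw2⟩ := key
  have hopen : IsOpen {w | dist w (q a) < η k / 2 ∧ 2 * η (k + 1) < dist w (q k)} :=
    (isOpen_lt (continuous_id.dist continuous_const) continuous_const).and
      (isOpen_lt continuous_const (continuous_id.dist continuous_const))
  obtain ⟨a', ha1, ha2⟩ := hq.exists_mem_open hopen ⟨w, hw1, hw2⟩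
  refine ⟨a', fun n hn => ?_, by rwa [dist_comm]⟩
  have hk := hη.pos (k + 1)
  rcases (Nat.lt_succ_iff.1 hn).lt_or_eq with h1 | rfl
  · have h2 := h n h1
    have h3 := hη.shrink k
    linarith [dist_triangle_left (q a) (q n) (q a')]
  · linarith

theorem exists_avoidsHoles_of_le (hη : IsHoleScale G η) [IsIsometricSMul G G] (hq : DenseRange q)
    {a k l : ℕ} (h : AvoidsHoles η q a k) (hl : k ≤ l) :
    ∃ a', AvoidsHoles η q a' l ∧ dist (q a) (q a') + η l ≤ η k := by
  induction l, hl using Nat.le_induction with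
  | base => exact ⟨a, h, by simp⟩
  | succ l _ ih =>
    obtain ⟨b, hb, hb'⟩ := ih
    obtain ⟨a', ha, ha'⟩ := hη.exists_avoidsHoles_succ hq hb
    refine ⟨a', ha, ?_⟩
    linarith [dist_triangle (q a) (q b) (q a'), hη.shrink l, hη.pos (l + 1)]

/-- A Banach–Mazur type argument: if countably many closed sets cover `holeComplement η q * x`,
then one of them meets all translates of small hole-avoiding balls. -/
theorem exists_forall_meets (hη : IsHoleScale G η) [IsIsometricSMul G G]
    [IsIsometricSMul Gᵐᵒᵖ G] [CompleteSpace G] (hq : DenseRange q) {F : ℕ → Set G}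
    {x : G} (hx : ∀ z ∈ holeComplement η q, ∃ j, z * x ∈ F j) :
    ∃ a k j, AvoidsHoles η q a k ∧ ∀ a' l, k ≤ l → AvoidsHoles η q a' l →
      dist (q a) (q a') + η l ≤ η k → ∃ z ∈ Metric.ball (q a') (η l), z * x ∈ F j := by
  by_contra! hcon
  -- Nested balls dodge the `F j` one by one; their common point avoids all holes, contradicting
  -- `hx`.
  have step : ∀ (j : ℕ) (p : {p : ℕ × ℕ // AvoidsHoles η q p.1 p.2}),
      ∃ p' : {p : ℕ × ℕ // AvoidsHoles η q p.1 p.2}, p.1.2 < p'.1.2 ∧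
        Metric.closedBall (q p'.1.1) (η p'.1.2) ⊆ Metric.ball (q p.1.1) (η p.1.2) ∧
        ∀ z ∈ Metric.closedBall (q p'.1.1) (η p'.1.2), z * x ∉ F j := by
    rintro j ⟨⟨a, k⟩, h⟩
    obtain ⟨a₁, l, hl, h₁, hd, hav⟩ := hcon a k j h
    obtain ⟨a₂, h₂, hd₂⟩ := hη.exists_avoidsHoles_succ hq h₁
    have hsub : Metric.closedBall (q a₂) (η (l + 1)) ⊆ Metric.ball (q a₁) (η l) := by
      refine Metric.closedBall_subset_ball' ?_
      rw [dist_comm]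
      linarith [hη.shrink l, hη.pos (l + 1)]
    refine ⟨⟨(a₂, l + 1), h₂⟩, Nat.lt_succ_of_le hl, hsub.trans ?_, fun z hz => hav z (hsub hz)⟩
    refine Metric.ball_subset_ball' ?_
    rw [dist_comm]
    linarith
  choose f hf1 hf2 hf3 using step
  let s : ℕ → {p : ℕ × ℕ // AvoidsHoles η q p.1 p.2} :=
    fun n => Nat.rec ⟨(0, 0), fun n hn => absurd hn (Nat.not_lt_zero n)⟩ f n
  have hs : ∀ n, s (n + 1) = f n (s n) := fun n => rfl
  have hk : ∀ n, n ≤ (s n).1.2 := by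
    intro n
    induction n with
    | zero => exact Nat.zero_le _
    | succ n ih => exact ih.trans_lt (hf1 n (s n))
  have hanti : Antitone fun n => Metric.closedBall (q (s n).1.1) (η (s n).1.2) :=
    antitone_nat_of_succ_le fun n => (hf2 n (s n)).trans Metric.ball_subset_closedBall
  have hcau : CauchySeq fun n => q (s n).1.1 := by
    refine cauchySeq_of_le_tendsto_0 (fun n => 2 * η n) (fun n m N hn hm => ?_)
      (by simpa using hη.tendsto_zero.const_mul 2)
    have h0 := hη.anti (hk N)
    have h1 : dist _ _ ≤ _ := hanti hn (Metric.mem_closedBall_self (hη.pos _).le)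
    have h2 : dist _ _ ≤ _ := hanti hm (Metric.mem_closedBall_self (hη.pos _).le)
    linarith [dist_triangle_right (q (s n).1.1) (q (s m).1.1) (q (s N).1.1)]
  obtain ⟨z, hz⟩ := cauchySeq_tendsto_of_complete hcau
  have hmem : ∀ n, z ∈ Metric.closedBall (q (s n).1.1) (η (s n).1.2) := fun n =>
    Metric.isClosed_closedBall.mem_of_tendsto hz (Filter.eventually_atTop.2
      ⟨n, fun m hm => hanti hm (Metric.mem_closedBall_self (hη.pos _).le)⟩)
  obtain ⟨j, hj⟩ := hx z fun n => by
    have h1 := (s (n + 1)).2 n (hk (n + 1))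
    have h2 : dist _ _ ≤ _ := hmem (n + 1)
    linarith [dist_triangle_left (q (s (n + 1)).1.1) (q n) z]
  exact hf3 j (s j) z (hmem (j + 1)) hj

/-- Points whose translates of hole-avoiding balls meet a fixed closed nowhere dense set lie in
translates of finitely many holes. -/
theorem hasHoleCovers (hη : IsHoleScale G η) [IsIsometricSMul G G] [IsIsometricSMul Gᵐᵒᵖ G]
    (hq : DenseRange q) {F Y : Set G} (hF : IsClosed F) (hF' : Dense Fᶜ) {a k : ℕ}
    (hak : AvoidsHoles η q a k)
    (hY : ∀ x ∈ Y, ∀ a' l, k ≤ l → AvoidsHoles η q a' l →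
      dist (q a) (q a') + η l ≤ η k → ∃ z ∈ Metric.ball (q a') (η l), z * x ∈ F) :
    HasHoleCovers η q Y k := by
  intro l hl x₀ N₀
  obtain ⟨b, hb, hb'⟩ := hη.exists_avoidsHoles_of_le hq hak hl
  have hηl := hη.pos l
  obtain ⟨y, hyF, hy⟩ := Metric.dense_iff.1 hF' (q b * x₀) (η l / 4) (by positivity)
  obtain ⟨δ, hδ, hδF⟩ := Metric.isOpen_iff.1 hF.isOpen_compl y hy
  obtain ⟨N, hN, hNδ⟩ := hη.exists_lt (lt_min (half_pos hδ) (half_pos (half_pos (half_pos hηl))))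
    (max N₀ l)
  rw [lt_min_iff] at hNδ
  refine ⟨N, (le_max_left _ _).trans hN, y, fun x hx => ?_⟩
  have hv1 : dist (y * x⁻¹) (y * x₀⁻¹) < η l / 4 := by
    rw [dist_mul_left, dist_inv_inv]
    exact hx.2
  have hv2 : dist (y * x₀⁻¹) (q b) < η l / 4 := by
    rw [← dist_mul_right _ _ x₀, inv_mul_cancel_right]
    exact hyF
  have hv : dist (y * x⁻¹) (q b) < η l / 2 := by
    linarith [dist_triangle (y * x⁻¹) (y * x₀⁻¹) (q b)]
  obtain ⟨e, he⟩ := hq.exists_dist_lt (y * x⁻¹) (hη.pos N)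
  have hbe : dist (q b) (q e) < η l / 2 + η N := by
    linarith [dist_triangle_left (q b) (q e) (y * x⁻¹)]
  -- Otherwise the ball about `q e`, translated by `x`, would meet `F` within `δ` of `y`.
  have hbad : ¬ AvoidsHoles η q e N := by
    intro hgood
    obtain ⟨z, hz, hzF⟩ := hY x hx.1 e N (hl.trans ((le_max_right _ _).trans hN)) hgood
      (by linarith [dist_triangle (q a) (q b) (q e)])
    refine hδF (?_ : z * x ∈ Metric.ball y δ) hzF
    rw [Metric.mem_ball, ← dist_mul_right _ _ x⁻¹, mul_inv_cancel_right]
    rw [Metric.mem_ball] at hz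
    linarith [dist_triangle_right z (y * x⁻¹) (q e)]
  simp only [AvoidsHoles, not_forall, not_lt] at hbad
  obtain ⟨n, hn, hne⟩ := hbad
  have hln : l ≤ n := by
    by_contra! hlt
    have := hb n hlt
    linarith [dist_triangle (q b) (q e) (q n)]
  simp only [Set.mem_iUnion, exists_prop]
  refine ⟨n, ⟨hln, hn⟩, ?_⟩
  rw [Metric.mem_ball, ← dist_mul_left (q n), mul_inv_cancel_left, ← dist_mul_right _ _ x⁻¹,
    mul_inv_cancel_right, dist_comm]
  linarith [dist_triangle (y * x⁻¹) (q e) (q n)]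

/-- A set with hole covers is totally bounded in the small. -/
theorem totallyBounded (hη : IsHoleScale G η) {Y : Set G} {k : ℕ} (hY : HasHoleCovers η q Y k)
    (x₀ : G) : TotallyBounded (Y ∩ Metric.ball x₀ (η k / 4)) := by
  have key : ∀ l ≥ k, ∃ t : Set G, t.Finite ∧
      Y ∩ Metric.ball x₀ (η k / 4) ⊆ ⋃ x ∈ t, Metric.ball x (η l / 4) := by
    intro l hl
    induction l, hl using Nat.le_induction with
    | base => exact ⟨{x₀}, Set.finite_singleton _, by simp⟩
    | succ l hl ih =>
      obtain ⟨t, ht, hsub⟩ := ih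
      -- With `N x ≥ l + 2`, the radii are at most `η (l + 1) / 16 + 2 * η (l + 2) ≤ η (l + 1) / 4`.
      choose N hN y hy using fun x => hY l hl x (l + 2)
      refine ⟨⋃ x ∈ t, (fun n => (q n)⁻¹ * y x) '' Set.Ico l (N x),
        ht.biUnion fun x _ => (Set.finite_Ico _ _).image _, fun z hz => ?_⟩
      have hzt := hsub hz
      simp only [Set.mem_iUnion, exists_prop] at hzt ⊢
      obtain ⟨x, hx, hzx⟩ := hzt
      have hzn := hy x ⟨hz.1, hzx⟩
      simp only [Set.mem_iUnion, exists_prop] at hzn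
      obtain ⟨n, hn, hzn⟩ := hzn
      refine ⟨_, ⟨x, hx, n, hn, rfl⟩, Metric.ball_subset_ball ?_ hzn⟩
      have h1 := hη.anti (Nat.succ_le_succ hn.1)
      have h2 := hη.anti (hN x)
      have h3 : 16 * η (l + 2) ≤ η (l + 1) := hη.shrink (l + 1)
      have h4 := hη.pos (l + 1)
      simp only [Nat.succ_eq_add_one] at h1
      linarith
  rw [Metric.totallyBounded_iff]
  intro ε hε
  obtain ⟨l, hl, hlε⟩ := hη.exists_lt hε k
  obtain ⟨t, ht, hsub⟩ := key l hl
  refine ⟨t, ht, hsub.trans (Set.iUnion₂_mono fun x _ => Metric.ball_subset_ball ?_)⟩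
  linarith [hη.pos l]

end IsHoleScale

theorem IsMeagre.exists_subset_iUnion_isClosed {X : Type*} [TopologicalSpace X] {s : Set X}
    (h : IsMeagre s) : ∃ F : ℕ → Set X, (∀ j, IsClosed (F j)) ∧ (∀ j, Dense (F j)ᶜ) ∧
      s ⊆ ⋃ j, F j := by
  obtain ⟨S, hS, hc, hsub⟩ := isMeagre_iff_countable_union_isNowhereDense.1 h
  rcases S.eq_empty_or_nonempty with rfl | hne
  · exact ⟨fun _ => ∅, by simp, by simp, by simpa using hsub⟩
  · obtain ⟨f, rfl⟩ := hc.exists_eq_range hne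
    refine ⟨fun j => closure (f j), fun j => isClosed_closure, fun j => ?_, hsub.trans ?_⟩
    · rw [← interior_eq_empty_iff_dense_compl]
      exact hS _ ⟨j, rfl⟩
    · rw [Set.sUnion_range]
      exact Set.iUnion_mono fun j => subset_closure

/-- A meager-additive set is a countable union of sets with hole covers. -/
theorem IsMeagerAdditive.exists_hasHoleCovers {G : Type*} [Group G] [MetricSpace G]
    [IsIsometricSMul G G] [IsIsometricSMul Gᵐᵒᵖ G] [CompleteSpace G] {X : Set G}
    (hX : IsMeagerAdditive X) {η : ℕ → ℝ} (hη : IsHoleScale G η) {q : ℕ → G} (hq : DenseRange q) :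
    ∃ (Y : ℕ → Set G) (k : ℕ → ℕ), X ⊆ ⋃ i, Y i ∧ ∀ i, HasHoleCovers η q (Y i) (k i) := by
  obtain ⟨F, hFc, hFd, hF⟩ :=
    (hX _ (isMeagre_holeComplement hη.pos hq)).exists_subset_iUnion_isClosed
  let Z : ℕ × ℕ × ℕ → Set G := fun p => {x | AvoidsHoles η q p.1 p.2.1 ∧
    ∀ a' l, p.2.1 ≤ l → AvoidsHoles η q a' l → dist (q p.1) (q a') + η l ≤ η p.2.1 →
      ∃ z ∈ Metric.ball (q a') (η l), z * x ∈ F p.2.2}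
  have hZ : ∀ p, HasHoleCovers η q (Z p) p.2.1 := by
    intro p
    by_cases hp : AvoidsHoles η q p.1 p.2.1
    · exact hη.hasHoleCovers hq (hFc _) (hFd _) hp fun x hx => hx.2
    · exact fun l _ x₀ N₀ => ⟨N₀, le_rfl, 1, fun x hx => absurd hx.1.1 hp⟩
  obtain ⟨e, he⟩ := exists_surjective_nat (ℕ × ℕ × ℕ)
  refine ⟨fun i => Z (e i), fun i => (e i).2.1, fun x hx => ?_, fun i => hZ _⟩
  obtain ⟨a, k, j, h1, h2⟩ := hη.exists_forall_meets hq fun z hz =>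
    Set.mem_iUnion.1 (hF (Set.mul_mem_mul hz hx))
  obtain ⟨i, hi⟩ := he (a, k, j)
  exact Set.mem_iUnion.2 ⟨i, by rw [hi]; exact ⟨h1, h2⟩⟩

/-! ### From hole covers to sharp measure zero -/

/-- A meager-additive set is contained in a `σ`-compact set. -/
theorem IsMeagerAdditive.exists_subset_iUnion_isCompact {G : Type*} [Group G] [MetricSpace G]
    [IsIsometricSMul G G] [IsIsometricSMul Gᵐᵒᵖ G] [CompleteSpace G] {X : Set G}
    (hX : IsMeagerAdditive X) (hG : ∀ r > 0, ∃ a : G, a ≠ 1 ∧ dist a 1 < r) {q : ℕ → G}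
    (hq : DenseRange q) :
    ∃ K : ℕ → Set G, (∀ i, IsCompact (K i)) ∧ Monotone K ∧ X ⊆ ⋃ i, K i := by
  obtain ⟨η, -, hη, -⟩ := exists_isHoleScale G hG (fun _ _ _ => 0) (fun _ _ => 1) fun _ _ => one_pos
  obtain ⟨Y, k, hXY, hY⟩ := hX.exists_hasHoleCovers hη hq
  obtain ⟨e, he⟩ := exists_surjective_nat (ℕ × ℕ)
  let T : ℕ → Set G := fun i =>
    closure (Y (e i).1 ∩ Metric.ball (q (e i).2) (η (k (e i).1) / 4))
  have hT : ∀ i, IsCompact (T i) := fun i =>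
    (hη.totallyBounded (hY _) _).closure.isCompact_of_isClosed isClosed_closure
  refine ⟨fun n => ⋃ i ∈ Set.Iic n, T i, fun n => (Set.finite_Iic n).isCompact_biUnion fun i _ => hT i,
    fun m n h => Set.biUnion_mono (Set.Iic_subset_Iic.2 h) fun _ _ => le_rfl, fun x hx => ?_⟩
  obtain ⟨i, hi⟩ := Set.mem_iUnion.1 (hXY hx)
  obtain ⟨b, hb⟩ := hq.exists_dist_lt x (div_pos (hη.pos (k i)) four_pos)
  obtain ⟨n, hn⟩ := he (i, b)
  refine Set.mem_iUnion.2 ⟨n, Set.mem_biUnion (Set.mem_Iic.2 le_rfl) (subset_closure ?_)⟩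
  rw [hn]
  exact ⟨hi, hb⟩

/-- A continuous map sends small pieces of a compact set to sets of small diameter. -/
theorem IsCompact.exists_ediam_image_ball_inter_le {E E' : Type*} [MetricSpace E] [MetricSpace E']
    {f : E → E'} (hf : Continuous f) {K : Set E} (hK : IsCompact K) {ε : ℝ} (hε : 0 < ε) :
    ∃ r > 0, ∀ x, Metric.ediam (f '' (Metric.ball x r ∩ K)) ≤ ENNReal.ofReal ε := by
  obtain ⟨δ, hδ, h⟩ := lebesgue_number_lemma_of_metric hK
    (c := fun z => f ⁻¹' Metric.ball (f z) (ε / 2)) (fun z => Metric.isOpen_ball.preimage hf)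
    fun z _ => Set.mem_iUnion.2 ⟨z, Metric.mem_ball_self (half_pos hε)⟩
  refine ⟨δ / 2, half_pos hδ, fun x => Metric.ediam_le ?_⟩
  rintro _ ⟨u, hu, rfl⟩ _ ⟨v, hv, rfl⟩
  obtain ⟨z, hz⟩ := h u hu.2
  have h1 : dist (f u) (f z) < ε / 2 := hz (Metric.mem_ball_self hδ)
  have h2 : dist (f v) (f z) < ε / 2 := by
    refine hz ?_
    have h3 := Metric.mem_ball.1 hu.1
    have h4 := Metric.mem_ball.1 hv.1
    rw [Metric.mem_ball]
    linarith [dist_triangle_right v u x]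
  rw [edist_dist]
  exact ENNReal.ofReal_le_ofReal (by linarith [dist_triangle_right (f u) (f v) (f z)])

/-- A compact set has finite covers by `c` balls of a given radius. -/
theorem IsCompact.exists_nat_cover {E : Type*} [MetricSpace E] [Nonempty E] {K : Set E}
    (hK : IsCompact K) {r : ℝ} (hr : 0 < r) :
    ∃ (c : ℕ) (x : ℕ → E), K ⊆ ⋃ t ∈ Set.Iio c, Metric.ball (x t) r := by
  obtain ⟨t, -, ht, hsub⟩ := hK.finite_cover_balls hr
  obtain ⟨c, f, -, rfl⟩ := ht.fin_param
  refine ⟨c, fun i => if h : i < c then f ⟨i, h⟩ else Classical.arbitrary E, hsub.trans ?_⟩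
  refine Set.iUnion₂_subset ?_
  rintro _ ⟨i, rfl⟩
  intro z hz
  simp only [Set.mem_iUnion, exists_prop]
  exact ⟨i, i.2, by simpa using hz⟩

/-- A meager-additive set has `γ`-groupable covers by sets of arbitrarily small size, where the
size is any monotone set function that is small on small pieces of compact sets. -/
theorem IsMeagerAdditive.exists_isGammaGroupableCover {G : Type*} [Group G] [MetricSpace G]
    [IsIsometricSMul G G] [IsIsometricSMul Gᵐᵒᵖ G] [CompleteSpace G] {X : Set G}
    (hX : IsMeagerAdditive X) (hG : ∀ r > 0, ∃ a : G, a ≠ 1 ∧ dist a 1 < r) {q : ℕ → G}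
    (hq : DenseRange q) {size : Set G → ENNReal} (hmono : Monotone size)
    (hsize : ∀ K, IsCompact K → ∀ ε > 0, ∃ r > 0, ∀ x,
      size (Metric.ball x r ∩ K) ≤ ENNReal.ofReal ε) {ε : ℕ → ℝ} (hε : ∀ n, 0 < ε n) :
    ∃ U : ℕ → Set G, IsGammaGroupableCover X U ∧ ∀ n, size (U n) ≤ ENNReal.ofReal (ε n) := by
  obtain ⟨K, hK, hKm, hXK⟩ := hX.exists_subset_iUnion_isCompact hG hq
  have hcov : ∀ n (r : ℝ), ∃ (c : ℕ) (x : ℕ → G), 0 < r →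
      K n ⊆ ⋃ t ∈ Set.Iio c, Metric.ball (x t) r := by
    intro n r
    by_cases hr : 0 < r
    · obtain ⟨c, x, h⟩ := (hK n).exists_nat_cover hr
      exact ⟨c, x, fun _ => h⟩
    · exact ⟨0, fun _ => 1, fun h => absurd h hr⟩
  choose cov x hcov using hcov
  have hsmall : ∀ n m, ∃ r > 0, ∀ z, ∀ p < m,
      size (Metric.ball z r ∩ K n) ≤
        ENNReal.ofReal (ε p) := by
    intro n m
    induction m with
    | zero => exact ⟨1, one_pos, fun z p hp => absurd hp (Nat.not_lt_zero p)⟩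
    | succ m ih =>
      obtain ⟨r, hr, h⟩ := ih
      obtain ⟨r', hr', h'⟩ := hsize _ (hK n) _ (hε m)
      refine ⟨min r r', lt_min hr hr', fun z p hp => ?_⟩
      rcases (Nat.lt_succ_iff.1 hp).lt_or_eq with h1 | rfl
      · exact (hmono
          (Set.inter_subset_inter_left _ (Metric.ball_subset_ball (min_le_left _ _)))).trans
          (h z p h1)
      · exact (hmono
          (Set.inter_subset_inter_left _ (Metric.ball_subset_ball (min_le_right _ _)))).trans
          (h' z)
  choose r hr hsmall using hsmall
  obtain ⟨η, c, hη, hc0, hc, hηr⟩ := exists_isHoleScale G hG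
    -- Block `n` must hold `n + 1` pieces times `cov` balls; doubling `m` also leaves room for the
    -- demands of all earlier stages. The divisor 3 absorbs the radius bound `3 * η (n + 1)`.
    (fun n e m => m + m + (n + 1) * cov n (e / 4) + 1) (fun n m => r n m / 3)
    fun n m => div_pos (hr n m) three_pos
  have hcm : StrictMono c := strictMono_nat_of_lt_succ fun n => by rw [hc]; omega
  have hroom : ∀ l n, l ≤ n → c n + (l + 1) * cov l (η l / 4) < c (n + 1) := by
    intro l n hln
    rcases hln.lt_or_eq with h | rfl
    · have h1 : c (l + 1) ≤ c n := hcm.monotone h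
      have h2 := hc l
      have h3 := hc n
      omega
    · have h3 := hc l
      omega
  obtain ⟨b, hb, hb'⟩ := exists_block_index hcm hc0
  obtain ⟨Y, k, hXY, hY⟩ := hX.exists_hasHoleCovers hη hq
  refine _root_.exists_isGammaGroupableCover
    (A := fun l => {z | ∃ i ≤ l, k i ≤ l ∧ z ∈ Y i ∧ z ∈ K l})
    (fun p U => size U ≤
      ENNReal.ofReal (ε p)) (fun z hz => ?_) hcm hc0 fun l => ?_
  · obtain ⟨i, hi⟩ := Set.mem_iUnion.1 (hXY hz)
    obtain ⟨j, hj⟩ := Set.mem_iUnion.1 (hXK hz)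
    exact ⟨max (max i j) (k i), fun l hl => ⟨i, by omega, by omega, hi,
      hKm (show j ≤ l by omega) hj⟩⟩
  -- `W u n` is the set of index `u` in the block `n`
  have hW : ∀ u, ∃ (N : ℕ) (W : ℕ → Set G), (∀ n, ∃ z, W n ⊆ Metric.ball z (3 * η (n + 1)) ∩ K n) ∧
      (k (u / cov l (η l / 4)) ≤ l → Y (u / cov l (η l / 4)) ∩ K l ∩
        Metric.ball (x l (η l / 4) (u % cov l (η l / 4))) (η l / 4) ⊆
          ⋃ n ∈ Set.Ico l N, W n) := by
    -- The offset `u` encodes a pair: the quotient selects the piece `Y i`, the remainder a ball of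
    -- the cover of `K l`.
    intro u
    by_cases hk : k (u / cov l (η l / 4)) ≤ l
    · obtain ⟨N, -, y, hy⟩ := hY _ l hk (x l (η l / 4) (u % cov l (η l / 4))) 0
      refine ⟨N, fun n => if n < N then
        Metric.ball ((q n)⁻¹ * y) (η (n + 1) / 16 + 2 * η N) ∩ K n else ∅, fun n => ?_,
        fun _ z hz => ?_⟩
      · refine ⟨(q n)⁻¹ * y, ?_⟩
        beta_reduce
        split_ifs with h
        · refine Set.inter_subset_inter_left _ (Metric.ball_subset_ball ?_)
          linarith [hη.anti (Nat.succ_le_of_lt h), hη.pos (n + 1)]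
        · exact Set.empty_subset _
      · have hz' := hy ⟨hz.1.1, hz.2⟩
        simp only [Set.mem_iUnion, exists_prop] at hz' ⊢
        obtain ⟨n, hn, hzn⟩ := hz'
        refine ⟨n, hn, ?_⟩
        rw [if_pos hn.2]
        exact ⟨hzn, hKm hn.1 hz.1.2⟩
    · exact ⟨0, fun _ => ∅, fun n => ⟨1, Set.empty_subset _⟩, fun h => absurd h hk⟩
  choose N W hW1 hW2 using hW
  let S := (l + 1) * cov l (η l / 4)
  refine ⟨(Finset.range S).sup N + l + 1, by omega, fun p => W (p - c (b p)) (b p),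
    fun p => ?_, ?_⟩
  · obtain ⟨z, hz⟩ := hW1 (p - c (b p)) (b p)
    refine (hmono
      (hz.trans (Set.inter_subset_inter_left _ (Metric.ball_subset_ball ?_)))).trans
      (hsmall (b p) (c (b p + 1)) z p (hb p).2)
    linarith [hηr (b p)]
  · rintro z ⟨i, hil, hki, hzY, hzK⟩
    have hzt := hcov l (η l / 4) (div_pos (hη.pos l) four_pos) hzK
    simp only [Set.mem_iUnion, exists_prop, Set.mem_Iio] at hzt ⊢
    obtain ⟨t, ht, hzt⟩ := hzt
    have hu1 : (cov l (η l / 4) * i + t) / cov l (η l / 4) = i := by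
      rw [Nat.mul_add_div (by omega), Nat.div_eq_of_lt ht, add_zero]
    have hu2 : (cov l (η l / 4) * i + t) % cov l (η l / 4) = t := by
      rw [Nat.mul_add_mod, Nat.mod_eq_of_lt ht]
    have huS : cov l (η l / 4) * i + t < S := by
      have : cov l (η l / 4) * i ≤ cov l (η l / 4) * l := Nat.mul_le_mul_left _ hil
      have : S = cov l (η l / 4) * l + cov l (η l / 4) := by ring
      omega
    have hz := hW2 (cov l (η l / 4) * i + t)
    rw [hu1, hu2] at hz
    have hz := hz hki ⟨⟨hzY, hzK⟩, hzt⟩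
    simp only [Set.mem_iUnion, exists_prop] at hz
    obtain ⟨n, hn, hzn⟩ := hz
    have h1 : c n + (cov l (η l / 4) * i + t) < c (n + 1) :=
      (Nat.add_lt_add_left huS _).trans (hroom l n hn.1)
    have hbn := hb' n _ (Nat.le_add_right _ _) h1
    have hN : N (cov l (η l / 4) * i + t) ≤ (Finset.range S).sup N :=
      Finset.le_sup (Finset.mem_range.2 huS)
    refine ⟨c n + (cov l (η l / 4) * i + t), ⟨(hcm.monotone hn.1).trans (Nat.le_add_right _ _),
      h1.trans_le (hcm.monotone ?_)⟩, ?_⟩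
    · have := hn.2
      omega
    · rwa [hbn, Nat.add_sub_cancel_left]

theorem theorem5p1 (G : Type*) [Group G] [τ : TopologicalSpace G] [IsTopologicalGroup G]
    [PolishSpace G] (hG : AdmitsInvariantMetric G) (X : Set G) (hX : IsMeagerAdditive X)
    (ρ : MetricSpace G) (hρ : IsCompatibleMetric τ ρ) :
    @HasSharpMeasureZero G ρ X := by
  obtain ⟨d, rfl, hl, hr⟩ := hG
  have : IsIsometricSMul G G := ⟨fun a => Isometry.of_dist_eq fun x y => hl a x y⟩
  have : IsIsometricSMul Gᵐᵒᵖ G := ⟨fun a => Isometry.of_dist_eq fun x y => hr a.unop x y⟩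
  have := completeSpace_of_isIsometricSMul G
  by_cases hd : ∀ r > 0, ∃ a : G, a ≠ 1 ∧ dist a 1 < r
  · intro ε hε
    refine hX.exists_isGammaGroupableCover hd (TopologicalSpace.denseRange_denseSeq G)
      (fun _ _ h => @Metric.ediam_mono G _ _ ρ.toPseudoMetricSpace.toPseudoEMetricSpace h)
      (fun K hK ε hε => ?_) hε
    -- The identity is uniformly continuous from `d` to `ρ` on compact sets, so small `d`-balls
    -- there have small `ρ`-diameter.
    have hcont : @Continuous G G d.toUniformSpace.toTopologicalSpace
        ρ.toUniformSpace.toTopologicalSpace id := by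
      rw [show ρ.toUniformSpace.toTopologicalSpace = _ from hρ]
      exact continuous_id
    simpa only [Set.image_id] using
      @IsCompact.exists_ediam_image_ball_inter_le G G d ρ id hcont K hK ε hε
  · push Not at hd
    obtain ⟨r, hr0, hd⟩ := hd
    have hdisc : DiscreteTopology G := by
      refine discreteTopology_of_isOpen_singleton_one (Metric.isOpen_iff.2 ?_)
      rintro _ rfl
      refine ⟨r, hr0, fun a ha => ?_⟩
      by_contra hne
      exact (hd a hne).not_gt ha
    have : Countable G := TopologicalSpace.separableSpace_iff_countable.1 inferInstance
    exact @HasSharpMeasureZero.of_countable G ρ _ _ X
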